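/- Let $K$ be a field, $S=K[x_1,\dots,x_n]$, and let $I\subset S$ be an ideal generated by quadratic monomials such that $(*)$ if $x_ix_j\in I$ with $i\neq j$, and $k>i$, $k>j$, then $x_ix_k\in I$ or $x_jx_k\in I$; $(**)$ if $x_i^2\in I$, $j>i$, and $k$ is such that $x_kx_j\in I$, then $x_ix_j\in I$ or $x_ix_k\in I$. Let $f_1,\dots,f_m$ be the distinct quadratic monomials in $I$ (the minimal monomial generators of $I$), let $T=S[y_1,\dots,y_m]$, and let $P$ be the kernel of the surjective $K$-algebra homomorphism $T\to R(I)=\bigoplus_{j\ge 0}I^jt^j\subset S[t]$ given by $x_i\mapsto x_i$, $y_j\mapsto f_jt$, so that $R(I)=T/P$ is the Rees ring of $I$. Then there is a lexicographic order $<_{lex}$ on $T$ (induced by some total order of the variables $x_1,\dots,x_n,y_1,\dots,y_m$) such that the reduced Gröbner basis $G$ of $P$ with respect to $<_{lex}$ consists of binomials $f$ (differences of two distinct monomials) with $\deg_x(f)\le 1$, where $\deg_x$ is the degree in the variables $x_1,\dots,x_n$, each $y_j$ having $x$-degree $0$. -/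

import Mathlib

open MvPolynomial

noncomputable section

/-- The quadratic monomial `x_i x_j` attached to an unordered pair `{i, j}` (with `i = j` allowed,
giving `x_i ^ 2`). -/
def quadMonomial (K : Type*) [Field K] {n : ℕ} (e : Sym2 (Fin n)) : MvPolynomial (Fin n) K :=
  Sym2.lift ⟨fun i j => X i * X j, fun i j => mul_comm (X i) (X j)⟩ e

/-- `I` is an ideal generated by (some set of) quadratic monomials. -/
def IsGeneratedByQuadMonomials {K : Type*} [Field K] {n : ℕ}
    (I : Ideal (MvPolynomial (Fin n) K)) : Prop :=
  ∃ D : Set (Sym2 (Fin n)), I = Ideal.span (quadMonomial K '' D)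

/-- The index set of the variables `y`: the pairs `{i, j}` with `x_i x_j ∈ I`. If `I` is generated
by quadratic monomials, these `x_i x_j` are the minimal monomial generators of `I`. -/
abbrev QuadGen {K : Type*} [Field K] {n : ℕ} (I : Ideal (MvPolynomial (Fin n) K)) : Type :=
  {e : Sym2 (Fin n) // quadMonomial K e ∈ I}

/-- The variables of the polynomial ring `T = S[y]`: `Sum.inl i` stands for `x_i`, and `Sum.inr e`
for the variable `y_e` attached to the generator `quadMonomial K e` of `I`. -/
abbrev ReesVar {K : Type*} [Field K] {n : ℕ} (I : Ideal (MvPolynomial (Fin n) K)) : Type :=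
  Fin n ⊕ QuadGen I

/-- The `K`-algebra homomorphism `T → R(I) ⊆ S[t]`, `x_i ↦ x_i`, `y_e ↦ f_e t`, where
`f_e = quadMonomial K e`. -/
def reesMap {K : Type*} [Field K] {n : ℕ} (I : Ideal (MvPolynomial (Fin n) K)) :
    MvPolynomial (ReesVar I) K →ₐ[K] reesAlgebra I :=
  aeval (Sum.elim
    (fun i => algebraMap (MvPolynomial (Fin n) K) (reesAlgebra I) (X i))
    (fun e => ⟨Polynomial.monomial 1 (quadMonomial K e.1),
      reesAlgebra.monomial_mem.mpr (by simpa using e.2)⟩))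

/-- The defining ideal `P` of the Rees ring `R(I) = T / P`. -/
def reesIdeal {K : Type*} [Field K] {n : ℕ} (I : Ideal (MvPolynomial (Fin n) K)) :
    Ideal (MvPolynomial (ReesVar I) K) :=
  RingHom.ker (reesMap I)

/-- The lexicographic monomial order induced by a linear order of the (finitely many) variables. -/
def lexOrder {σ : Type*} [Finite σ] (r : LinearOrder σ) : MonomialOrder σ :=
  @MonomialOrder.lex σ r (@Finite.to_wellFoundedGT σ _ r.toPreorder)

/-- A finite subset `G` of the ideal `J` is a Gröbner basis of `J` if the leading terms of its
elements generate the initial ideal of `J`. -/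
def IsGroebnerBasis {σ K : Type*} [Field K] (m : MonomialOrder σ)
    (J : Ideal (MvPolynomial σ K)) (G : Finset (MvPolynomial σ K)) : Prop :=
  (∀ g ∈ G, g ∈ J) ∧
    Ideal.span (m.leadingTerm '' (G : Set (MvPolynomial σ K))) =
      Ideal.span (m.leadingTerm '' (J : Set (MvPolynomial σ K)))

/-- A Gröbner basis is reduced if its elements are monic and no monomial of an element is divisible
by the leading monomial of another element. -/
def IsReducedGroebnerBasis {σ K : Type*} [Field K] (m : MonomialOrder σ)
    (J : Ideal (MvPolynomial σ K)) (G : Finset (MvPolynomial σ K)) : Prop :=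
  IsGroebnerBasis m J G ∧ (∀ g ∈ G, m.Monic g) ∧
    ∀ g ∈ G, ∀ h ∈ G, h ≠ g → ∀ d ∈ g.support, ¬ m.degree h ≤ d

/-- A binomial: a difference of two distinct monomials. -/
def IsBinomial {σ K : Type*} [Field K] (f : MvPolynomial σ K) : Prop :=
  ∃ u v : σ →₀ ℕ, u ≠ v ∧ f = monomial u 1 - monomial v 1

/-- The `x`-degree on `T`: every `x_i` has degree `1` and every `y_e` has degree `0`. -/
def xDegree {K : Type*} [Field K] {n : ℕ} {I : Ideal (MvPolynomial (Fin n) K)}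
    (f : MvPolynomial (ReesVar I) K) : ℕ :=
  weightedTotalDegree (Sum.elim (fun _ => 1) (fun _ => 0) : ReesVar I → ℕ) f

end

/-!
The ideal `P` is the kernel of a monomial map, so its reduced Gröbner basis for any monomial order
consists of binomials `u - v`, where `u` is a minimal generator of the initial ideal and `v` is the
smallest monomial with the same image as `u`
(`exists_isReducedGroebnerBasis_of_fiber`). Since `u` and `v` have the same `x`-degree, it
remains to choose the order of the variables such that `u` has `x`-degree at most one.

View `y_{ij}` as an edge `{i, j}` and `x_i` as an edge from `i` to an extra vertex `∞`. Two monomials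
have the same image iff they have the same degree at every vertex, so `u` and `v` decompose into
closed trails alternating between edges of `u` and edges of `v`. By minimality no proper
subfamily of trails is balanced. Hence, if the `x`-degree is at least two, an alternating trail
which leaves `∞` through an `x` of `u` returns through an `x` of `u`, and likewise for `v`
(`IsXPrimitive.exists_closed_trail`, `IsXPrimitive.exists_edge_left`,
`IsXPrimitive.exists_edge_right`).

Order the variables so that `y_e` is larger than `y_f` if the larger end of `e` is smaller than that
of `f`, or these agree and the smaller end of `e` is larger than that of `f`; the variables `x` come
last. Let `z` be the largest variable in `u` and `v`, and `g` an edge on a trail of the kind opposite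
to the trail of `z`. These trails have no common vertex except `∞`, and the larger end of `g` is
beyond both ends of `z`. The condition `(*)`, or `(**)` if `z` is a loop, then gives an edge `e` of
`I` from an end of `z` to an end of `g` with `y_e` smaller than `z`. Replacing parts of both trails
by `e` shows that a proper divisor of `u` or `v`, one that contains `z`, lies in the initial ideal,
a contradiction (`false_of_largest_mem_right`).
-/

/-! ### Reduced Gröbner bases of toric ideals -/

/-- For a grading `π` of the monomials, `u` is initial if its `π`-fibre contains a smaller monomial.
For the kernel of a monomial map with exponent map `π`, these are the exponents of the monomials in
the initial ideal. -/
def MonomialOrder.IsInitial {σ M : Type*} [AddCommMonoid M] (m : MonomialOrder σ)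
    (π : (σ →₀ ℕ) →+ M) (u : σ →₀ ℕ) : Prop :=
  ∃ v, π v = π u ∧ m.toSyn v < m.toSyn u

section Toric

variable {σ M : Type*} [AddCommMonoid M] {m : MonomialOrder σ} {π : (σ →₀ ℕ) →+ M}

theorem MonomialOrder.IsInitial.mono {u w : σ →₀ ℕ} (h : m.IsInitial π u) (huw : u ≤ w) :
    m.IsInitial π w := by
  obtain ⟨v, hv, hlt⟩ := h
  obtain ⟨t, rfl⟩ := exists_add_of_le huw
  exact ⟨v + t, by simp [hv], by simpa using hlt⟩

theorem MonomialOrder.exists_not_isInitial (m : MonomialOrder σ) (π : (σ →₀ ℕ) →+ M)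
    (u : σ →₀ ℕ) : ∃ v, π v = π u ∧ ¬ m.IsInitial π v := by
  induction h : m.toSyn u using WellFoundedLT.induction generalizing u with
  | ind s ih =>
    subst h
    by_cases hu : m.IsInitial π u
    · obtain ⟨v, hv, hlt⟩ := hu
      obtain ⟨w, hw, hw'⟩ := ih _ hlt v rfl
      exact ⟨w, hw.trans hv, hw'⟩
    · exact ⟨u, rfl, hu⟩

/-- Let the ideal `J` contain the binomials with both terms in one fibre of `π`, and let no fibre
meet the support of an element of `J` in exactly one monomial (both hold for the kernel of a
monomial map with exponent map `π`). Then the binomials whose first term is a minimal generator of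
the initial ideal, and whose second term is the smallest monomial in the same fibre, form a reduced
Gröbner basis of `J`. -/
theorem exists_isReducedGroebnerBasis_of_fiber {K : Type*} [Field K] [Finite σ]
    (m : MonomialOrder σ) (π : (σ →₀ ℕ) →+ M) (J : Ideal (MvPolynomial σ K))
    (hbin : ∀ u v, π u = π v → (monomial u 1 - monomial v 1 : MvPolynomial σ K) ∈ J)
    (hsupp : ∀ f ∈ J, ∀ u ∈ f.support, ∃ v ∈ f.support, v ≠ u ∧ π v = π u) :
    ∃ G : Finset (MvPolynomial σ K), IsReducedGroebnerBasis m J G ∧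
      ∀ f ∈ G, ∃ u v, f = monomial u 1 - monomial v 1 ∧ u ≠ v ∧ π u = π v ∧
        (∀ w ≤ u, w ≠ u → ¬ m.IsInitial π w) ∧ ¬ m.IsInitial π v := by
  classical
  choose nf hnf hnf' using m.exists_not_isInitial π
  have hfin : {u | Minimal (m.IsInitial π) u}.Finite :=
    WellQuasiOrderedLE.finite_of_isAntichain (setOfPred_minimal_antichain _)
  have hlt : ∀ u, m.IsInitial π u → m.toSyn (nf u) < m.toSyn u := by
    intro u hu
    by_contra! hcon
    obtain ⟨v, hv, hvu⟩ := hu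
    exact hnf' u ⟨v, hv.trans (hnf u).symm, hvu.trans_le hcon⟩
  set b : (σ →₀ ℕ) → MvPolynomial σ K := fun u => monomial u 1 - monomial (nf u) 1 with hb
  have hmonlt : ∀ u, m.IsInitial π u → m.toSyn (m.degree (monomial (nf u) (1 : K))) <
      m.toSyn (m.degree (monomial u (1 : K))) := by
    intro u hu
    simpa [m.degree_monomial] using hlt u hu
  have hdeg : ∀ u, m.IsInitial π u → m.degree (b u) = u := by
    intro u hu
    rw [hb]
    simp only
    rw [m.degree_sub_of_lt (hmonlt u hu)]
    simp [m.degree_monomial]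
  have hmonic : ∀ u, m.IsInitial π u → m.Monic (b u) := by
    intro u hu
    rw [hb, MonomialOrder.Monic]
    simp only
    rw [m.leadingCoeff_sub_of_lt (hmonlt u hu)]
    simp
  have hbJ : ∀ u, b u ∈ J := fun u => hbin _ _ (hnf u).symm
  have hbs : ∀ u, ∀ d ∈ (b u).support, d = u ∨ d = nf u := by
    intro u d hd
    by_contra! hcon
    rw [mem_support_iff] at hd
    simp [hb, coeff_monomial, hcon.1.symm, hcon.2.symm] at hd
  refine ⟨hfin.toFinset.image b, ⟨⟨?_, ?_⟩, ?_, ?_⟩, ?_⟩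
  · intro g hg
    obtain ⟨u, -, rfl⟩ := Finset.mem_image.1 hg
    exact hbJ u
  · apply le_antisymm
    · apply Ideal.span_mono
      apply Set.image_mono
      intro g hg
      obtain ⟨u, -, rfl⟩ := Finset.mem_image.1 (Finset.mem_coe.1 hg)
      exact hbJ u
    · rw [Ideal.span_le]
      rintro _ ⟨f, hf, rfl⟩
      by_cases hf0 : f = 0
      · simp [hf0]
      obtain ⟨v, hv, hvne, hvπ⟩ := hsupp f hf _ (m.degree_mem_support hf0)
      have hin : m.IsInitial π (m.degree f) := by
        refine ⟨v, hvπ, lt_of_le_of_ne (m.le_degree hv) fun h => hvne (m.toSyn.injective h)⟩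
      obtain ⟨u, hu, hmin⟩ := exists_minimal_le_of_wellFoundedLT _ _ hin
      obtain ⟨t, ht⟩ := exists_add_of_le hu
      have hlt : m.leadingTerm f = monomial t (m.leadingCoeff f) * m.leadingTerm (b u) := by
        rw [MonomialOrder.leadingTerm, MonomialOrder.leadingTerm, hdeg u hmin.prop,
          (hmonic u hmin.prop).leadingCoeff_eq_one, monomial_mul, mul_one, ht, add_comm]
      rw [SetLike.mem_coe, hlt]
      refine Ideal.mul_mem_left _ _ (Ideal.subset_span ⟨b u, ?_, rfl⟩)
      exact Finset.mem_coe.2 (Finset.mem_image_of_mem _ (hfin.mem_toFinset.2 hmin))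
  · intro g hg
    obtain ⟨u, hu, rfl⟩ := Finset.mem_image.1 hg
    exact hmonic u (hfin.mem_toFinset.1 hu).prop
  · intro g hg h hh hne d hd hle
    obtain ⟨u, hu, rfl⟩ := Finset.mem_image.1 hg
    obtain ⟨w, hw, rfl⟩ := Finset.mem_image.1 hh
    have hu : Minimal (m.IsInitial π) u := hfin.mem_toFinset.1 hu
    have hw : Minimal (m.IsInitial π) w := hfin.mem_toFinset.1 hw
    rw [hdeg w hw.prop] at hle
    rcases hbs u d hd with rfl | rfl
    · exact hne (by rw [hu.eq_of_le hw.prop hle])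
    · exact hnf' u (hw.prop.mono hle)
  · intro f hf
    obtain ⟨u, hu, rfl⟩ := Finset.mem_image.1 hf
    have hu : Minimal (m.IsInitial π) u := hfin.mem_toFinset.1 hu
    refine ⟨u, nf u, rfl, ?_, (hnf u).symm, fun w hw hne hin => hne (hu.eq_of_le hin hw),
      hnf' u⟩
    intro h
    exact (hlt u hu.prop).ne (by rw [← h])

end Toric

/-! ### Degrees of monomials in the variables `x` and `y` -/

section Degrees

open Finsupp

variable {α : Type*} {p : Sym2 α → Prop}

/-- The degree of a monomial of `K[x, y]` at each vertex: `x_i` counts once at `i`, and `y_{ij}`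
counts once at `i` and once at `j`. This is the exponent of the image in `K[x]` under `x_i ↦ x_i`,
`y_{ij} ↦ x_i x_j`. -/
noncomputable def vertexDeg (p : Sym2 α → Prop) : (α ⊕ Subtype p →₀ ℕ) →+ (α →₀ ℕ) :=
  weight (Sum.elim (fun i => single i 1) fun e => Sym2.lift
    ⟨fun i j => single i 1 + single j 1, fun _ _ => add_comm _ _⟩ e.1)

/-- The degree of a monomial in the variables `x`. -/
noncomputable def xDeg (p : Sym2 α → Prop) : (α ⊕ Subtype p →₀ ℕ) →+ ℕ :=
  weight (Sum.elim (fun _ => 1) fun _ => 0)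

/-- The degree of a monomial in the variables `y`. -/
noncomputable def yDeg (p : Sym2 α → Prop) : (α ⊕ Subtype p →₀ ℕ) →+ ℕ :=
  weight (Sum.elim (fun _ => 0) fun _ => 1)

/-- The exponent of the image of a monomial under `x_i ↦ x_i`, `y_{ij} ↦ x_i x_j t`. -/
noncomputable def reesDeg (p : Sym2 α → Prop) : (α ⊕ Subtype p →₀ ℕ) →+ (α →₀ ℕ) × ℕ :=
  (vertexDeg p).prod (yDeg p)

@[simp] theorem vertexDeg_single_inl (i : α) :
    vertexDeg p (single (Sum.inl i) 1) = single i 1 := by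
  simp [vertexDeg, weight_single]

theorem vertexDeg_single_inr {e : Subtype p} {i j : α} (h : e.1 = s(i, j)) :
    vertexDeg p (single (Sum.inr e) 1) = single i 1 + single j 1 := by
  simp [vertexDeg, weight_single, h]

@[simp] theorem xDeg_single_inl (i : α) : xDeg p (single (Sum.inl i) 1) = 1 := by
  simp [xDeg, weight_single]

@[simp] theorem xDeg_single_inr (e : Subtype p) : xDeg p (single (Sum.inr e) 1) = 0 := by
  simp [xDeg, weight_single]

@[simp] theorem yDeg_single_inl (i : α) : yDeg p (single (Sum.inl i) 1) = 0 := by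
  simp [yDeg, weight_single]

@[simp] theorem yDeg_single_inr (e : Subtype p) : yDeg p (single (Sum.inr e) 1) = 1 := by
  simp [yDeg, weight_single]

theorem degree_vertexDeg (a : α ⊕ Subtype p →₀ ℕ) :
    (vertexDeg p a).degree = xDeg p a + 2 * yDeg p a := by
  induction a using Finsupp.induction_linear with
  | zero => simp
  | add a b ha hb => simp only [map_add, ha, hb]; ring
  | single s k =>
    have hs : single s k = k • single s 1 := by simp
    rw [hs]
    simp only [map_nsmul, smul_eq_mul]
    rcases s with i | ⟨⟨i, j⟩, he⟩
    · simp
    · rw [vertexDeg_single_inr (i := i) (j := j) rfl]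
      simp
      ring

/-- In terms of graphs, counting `x_i` as an edge from `i` to an extra vertex: two monomials have
the same image in the Rees ring iff they have the same degree at every vertex. -/
theorem reesDeg_eq_iff {a b : α ⊕ Subtype p →₀ ℕ} :
    reesDeg p a = reesDeg p b ↔ vertexDeg p a = vertexDeg p b ∧ xDeg p a = xDeg p b := by
  have ha := degree_vertexDeg a
  have hb := degree_vertexDeg b
  simp only [reesDeg, AddMonoidHom.prod_apply, Prod.mk.injEq]
  refine and_congr_right fun h => ?_
  rw [h] at ha
  omega

theorem exists_add_of_apply_ne_zero {σ : Type*} {U : σ →₀ ℕ} {s : σ} (h : U s ≠ 0) :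
    ∃ U', U = single s 1 + U' :=
  exists_add_of_le (single_le_iff.2 (Nat.one_le_iff_ne_zero.2 h))

theorem exists_apply_ne_zero_of_vertexDeg {U : α ⊕ Subtype p →₀ ℕ} {c : α}
    (h : vertexDeg p U c ≠ 0) :
    U (Sum.inl c) ≠ 0 ∨ ∃ e : Subtype p, U (Sum.inr e) ≠ 0 ∧ ∃ d, e.1 = s(c, d) := by
  contrapose! h
  obtain ⟨hx, hy⟩ := h
  rw [vertexDeg, weight_apply, Finsupp.sum, finsetSum_apply]
  refine Finset.sum_eq_zero fun s hs => ?_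
  rw [Finsupp.mem_support_iff] at hs
  rcases s with i | e
  · have : i ≠ c := by rintro rfl; exact hs hx
    simp [this]
  · obtain ⟨⟨i, j⟩, he⟩ := e
    have h1 : i ≠ c := by rintro rfl; exact hy _ hs j rfl
    have h2 : j ≠ c := by rintro rfl; exact hy _ hs i Sym2.eq_swap
    simp [h1, h2]

theorem exists_apply_inl_ne_zero_of_xDeg {U : α ⊕ Subtype p →₀ ℕ} (h : xDeg p U ≠ 0) :
    ∃ i, U (Sum.inl i) ≠ 0 := by
  contrapose! h
  rw [xDeg, weight_apply, Finsupp.sum]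
  refine Finset.sum_eq_zero fun s _ => ?_
  rcases s with i | e <;> simp [h]

/-! ### Alternating trails -/

/-- An alternating trail from `c`: starting at `c` with an edge of `U`, edges of `U` and `V`
alternate. The trail is followed until it uses a variable `x_i`, or until it arrives through an
edge of `U` at a vertex `q` where `V` is exhausted; the latter needs an excess of `U` over `V` at
`q` besides the one that made the trail start at `c`. The monomials `a` and `b` collect the edges
of `U` and `V` on the trail. -/
theorem exists_alternating_trail {U V : α ⊕ Subtype p →₀ ℕ} {c : α}
    (h : vertexDeg p V + single c 1 ≤ vertexDeg p U) :
    ∃ a ≤ U, ∃ b ≤ V,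
      (vertexDeg p a = vertexDeg p b + single c 1 ∧ xDeg p a + xDeg p b = 1) ∨
      ∃ q, vertexDeg p a = vertexDeg p b + single c 1 + single q 1 ∧ xDeg p a = 0 ∧
        xDeg p b = 0 ∧ vertexDeg p V q + single c 1 q + 1 ≤ vertexDeg p U q := by
  induction hN : U.degree generalizing U V c with
  | zero =>
    have hU : U = 0 := (Finsupp.degree_eq_zero_iff _).1 hN
    have := h c
    simp [hU] at this
  | succ N ih =>
    have hc : vertexDeg p U c ≠ 0 := by
      have := h c
      simp only [Finsupp.add_apply, single_eq_same] at this
      omega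
    rcases exists_apply_ne_zero_of_vertexDeg hc with hx | ⟨e, he, q, heq⟩
    · exact ⟨single (Sum.inl c) 1, single_le_iff.2 (Nat.one_le_iff_ne_zero.2 hx), 0, zero_le,
        Or.inl (by simp)⟩
    obtain ⟨U, rfl⟩ := exists_add_of_apply_ne_zero he
    by_cases hq : vertexDeg p V q = 0
    · refine ⟨single (Sum.inr e) 1, le_self_add, 0, zero_le, Or.inr ⟨q, ?_⟩⟩
      simp only [map_add, vertexDeg_single_inr heq, map_zero, Finsupp.add_apply, single_eq_same, hq,
        xDeg_single_inr]
      exact ⟨by simp, trivial, trivial, by omega⟩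
    rcases exists_apply_ne_zero_of_vertexDeg hq with hx | ⟨f, hf, t, hft⟩
    · refine ⟨single (Sum.inr e) 1, le_self_add, single (Sum.inl q) 1,
        single_le_iff.2 (Nat.one_le_iff_ne_zero.2 hx), Or.inl ?_⟩
      simp [vertexDeg_single_inr heq, add_comm]
    obtain ⟨V, rfl⟩ := exists_add_of_apply_ne_zero hf
    simp only [map_add, vertexDeg_single_inr heq, vertexDeg_single_inr hft] at h ⊢
    have h' : vertexDeg p V + single t 1 ≤ vertexDeg p U := by
      intro s
      have := h s
      simp only [Finsupp.add_apply] at this ⊢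
      omega
    obtain ⟨a, ha, b, hb, hab⟩ := ih h' (by rw [map_add, Finsupp.degree_single] at hN; omega)
    refine ⟨single (Sum.inr e) 1 + a, by gcongr, single (Sum.inr f) 1 + b, by gcongr, ?_⟩
    simp only [map_add, vertexDeg_single_inr heq, vertexDeg_single_inr hft, xDeg_single_inr,
      zero_add]
    refine hab.imp (fun hab => ⟨by rw [hab.1]; abel, hab.2⟩) ?_
    rintro ⟨s, hs, hxa, hxb, hle⟩
    refine ⟨s, by rw [hs]; abel, hxa, hxb, ?_⟩
    simp only [Finsupp.add_apply]
    omega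

/-- If `U` exceeds `V` by one vertex `c` only, an alternating trail from `c` uses a variable
`x_i`. -/
theorem exists_alternating_trail_of_eq {U V : α ⊕ Subtype p →₀ ℕ} {c : α}
    (h : vertexDeg p U = vertexDeg p V + single c 1) :
    ∃ a ≤ U, ∃ b ≤ V, vertexDeg p a = vertexDeg p b + single c 1 ∧ xDeg p a + xDeg p b = 1 := by
  obtain ⟨a, ha, b, hb, hab | ⟨q, -, -, -, hle⟩⟩ := exists_alternating_trail h.ge
  · exact ⟨a, ha, b, hb, hab⟩
  · rw [h, Finsupp.add_apply] at hle
    omega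

/-- A pair of monomials is `x`-primitive if it has no nontrivial balanced pair of divisors of
`x`-degree at most one. -/
def IsXPrimitive (u v : α ⊕ Subtype p →₀ ℕ) : Prop :=
  ∀ a ≤ u, ∀ b ≤ v, vertexDeg p a = vertexDeg p b → xDeg p a = xDeg p b → xDeg p a ≤ 1 →
    a = 0 ∧ b = 0

theorem IsXPrimitive.mono {u v u' v' : α ⊕ Subtype p →₀ ℕ} (h : IsXPrimitive u v) (hu : u' ≤ u)
    (hv : v' ≤ v) : IsXPrimitive u' v' :=
  fun a ha b hb => h a (ha.trans hu) b (hb.trans hv)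

theorem IsXPrimitive.symm {u v : α ⊕ Subtype p →₀ ℕ} (h : IsXPrimitive u v) :
    IsXPrimitive v u :=
  fun a ha b hb h1 h2 h3 => (h b hb a ha h1.symm h2.symm (h2 ▸ h3)).symm

/-- A variable `x_k` of `U` is followed by an edge `g` of `V` at `k`, and the trail continues to
another variable of `U`: so there are trails avoiding `g` from both ends of `g`. -/
theorem IsXPrimitive.exists_edge_right {U V : α ⊕ Subtype p →₀ ℕ} (hprim : IsXPrimitive U V)
    (h : vertexDeg p U = vertexDeg p V) (hx : xDeg p U ≠ 0) :
    ∃ g : Subtype p, V (Sum.inr g) ≠ 0 ∧ ∀ k ∈ g.1, ∃ a ≤ U, ∃ b,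
      single (Sum.inr g) 1 + b ≤ V ∧ vertexDeg p a = vertexDeg p b + single k 1 ∧
      xDeg p a = 1 ∧ xDeg p b = 0 := by
  obtain ⟨k, hk⟩ := exists_apply_inl_ne_zero_of_xDeg hx
  obtain ⟨U, rfl⟩ := exists_add_of_apply_ne_zero hk
  have hVk : vertexDeg p V k ≠ 0 := by
    rw [← h]
    simp
  rcases exists_apply_ne_zero_of_vertexDeg hVk with hV | ⟨g, hg, l, hgl⟩
  · have := hprim _ le_self_add (single (Sum.inl k) 1)
      (single_le_iff.2 (Nat.one_le_iff_ne_zero.2 hV)) rfl rfl (by simp)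
    simp at this
  obtain ⟨V, rfl⟩ := exists_add_of_apply_ne_zero hg
  simp only [map_add, vertexDeg_single_inl, vertexDeg_single_inr hgl] at h
  have h' : vertexDeg p U = vertexDeg p V + single l 1 := by
    apply add_left_cancel (a := single k 1)
    rw [h]
    abel
  obtain ⟨a, ha, b, hb, hab, hxab⟩ := exists_alternating_trail_of_eq h'
  refine ⟨g, hg, fun k' hk' => ?_⟩
  rw [hgl, Sym2.mem_iff] at hk'
  rcases hk' with rfl | rfl
  · exact ⟨single (Sum.inl k') 1, le_self_add, 0, by simp, by simp, by simp, by simp⟩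
  · refine ⟨a, ha.trans le_add_self, b, by gcongr, hab, ?_⟩
    by_contra hcon
    have := hprim (single (Sum.inl k) 1 + a) (by gcongr) (single (Sum.inr g) 1 + b) (by gcongr)
      (by simp only [map_add, vertexDeg_single_inl, vertexDeg_single_inr hgl, hab]; abel)
      (by simp only [map_add, xDeg_single_inl, xDeg_single_inr]; omega)
      (by simp only [map_add, xDeg_single_inl]; omega)
    simp at this

/-- The version of `IsXPrimitive.exists_edge_right` for a variable of `V`; the trails still begin
with an edge of `U`, so that they now run through `g`. -/
theorem IsXPrimitive.exists_edge_left {U V : α ⊕ Subtype p →₀ ℕ} (hprim : IsXPrimitive U V)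
    (h : vertexDeg p U = vertexDeg p V) (hx : xDeg p V ≠ 0) :
    ∃ g : Subtype p, U (Sum.inr g) ≠ 0 ∧ ∀ k ∈ g.1, ∃ a ≤ U, ∃ b ≤ V,
      vertexDeg p a = vertexDeg p b + single k 1 ∧ xDeg p a = 0 ∧ xDeg p b = 1 := by
  obtain ⟨g, hg, H⟩ := hprim.symm.exists_edge_right h.symm hx
  refine ⟨g, hg, fun k hk => ?_⟩
  obtain ⟨l, hkl⟩ := hk
  obtain ⟨b, hb, a, ha, hab, hxb, hxa⟩ := H l (by rw [hkl]; exact Sym2.mem_mk_right _ _)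
  refine ⟨_, ha, b, hb, ?_, by simp [hxa], hxb⟩
  rw [map_add, vertexDeg_single_inr hkl, hab]
  abel

/-- The closed trail through an edge `z = {c, d}` of `v` passes the variables `x` exactly twice,
both times on the same side; it consists of `z` and two trails from the two ends of `z`. Here
`(U, V)` is what the closed trail leaves over, and for either end `c` of `z`, the pair `(a, b)` is
the trail from `c`, and `(a', b')` the one from the other end. -/
theorem IsXPrimitive.exists_closed_trail {u v : α ⊕ Subtype p →₀ ℕ} (hprim : IsXPrimitive u v)
    (h : vertexDeg p u = vertexDeg p v) {z : Subtype p} (hz : v (Sum.inr z) ≠ 0) :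
    ∃ U V, ∃ s t, s + t = 1 ∧ ∀ c ∈ z.1, ∃ a b a' b',
      u = a + a' + U ∧ v = single (Sum.inr z) 1 + b + b' + V ∧
      vertexDeg p a = vertexDeg p b + single c 1 ∧
      vertexDeg p (single (Sum.inr z) 1 + b') = vertexDeg p a' + single c 1 ∧
      xDeg p a = s ∧ xDeg p a' = s ∧ xDeg p b = t ∧ xDeg p b' = t := by
  obtain ⟨z, hz'⟩ := z
  induction z with | _ c d
  set z : Subtype p := ⟨s(c, d), hz'⟩
  have hzcd : z.1 = s(c, d) := rfl
  obtain ⟨V, rfl⟩ := exists_add_of_apply_ne_zero hz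
  rw [map_add, vertexDeg_single_inr hzcd] at h
  have h1 : vertexDeg p V + single c 1 ≤ vertexDeg p u := by
    rw [h]
    intro s
    simp only [Finsupp.add_apply]
    omega
  have hzne (b : α ⊕ Subtype p →₀ ℕ) : single (Sum.inr z) 1 + b ≠ 0 := by simp
  obtain ⟨a, ha, b, hb, ⟨hab, hxab⟩ | ⟨q, hab, hxa, hxb, hle⟩⟩ := exists_alternating_trail h1
  swap
  · -- a trail from `c` that stops does so at `d`, where `z` closes it
    have hqd : q = d := by
      by_contra hne
      rw [h, Finsupp.add_apply, Finsupp.add_apply, single_eq_of_ne hne] at hle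
      omega
    subst hqd
    refine absurd (hprim a ha (single (Sum.inr z) 1 + b) (by gcongr) ?_ ?_ ?_).2 (hzne b)
    · rw [map_add, vertexDeg_single_inr hzcd, hab]
      abel
    · simp [hxa, hxb]
    · omega
  obtain ⟨U, rfl⟩ := exists_add_of_le ha
  obtain ⟨V, rfl⟩ := exists_add_of_le hb
  have h2 : vertexDeg p U = vertexDeg p V + single d 1 := by
    rw [map_add, map_add, hab] at h
    apply add_left_cancel (a := vertexDeg p b + single c 1)
    rw [h]
    abel
  obtain ⟨a', ha', b', hb', hab', hxab'⟩ := exists_alternating_trail_of_eq h2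
  obtain ⟨U, rfl⟩ := exists_add_of_le ha'
  obtain ⟨V, rfl⟩ := exists_add_of_le hb'
  have hxeq : xDeg p a = xDeg p a' := by
    by_contra hne
    refine hzne (b + b') (hprim (a + a') (by gcongr) (single (Sum.inr z) 1 + (b + b')) (by gcongr)
      ?_ ?_ ?_).2
    · simp only [map_add, vertexDeg_single_inr hzcd, hab, hab']
      abel
    · simp only [map_add, xDeg_single_inr]
      omega
    · simp only [map_add]
      omega
  refine ⟨U, V, xDeg p a, xDeg p b, hxab, fun k hk => ?_⟩
  rw [hzcd, Sym2.mem_iff] at hk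
  rcases hk with rfl | rfl
  · refine ⟨a, b, a', b', by abel, by abel, hab, ?_, rfl, hxeq.symm, rfl, by omega⟩
    rw [map_add, vertexDeg_single_inr hzcd, hab']
    abel
  · refine ⟨a', b', a, b, by abel, by abel, hab', ?_, hxeq.symm, rfl, by omega, rfl⟩
    rw [map_add, vertexDeg_single_inr hzcd, hab]
    abel

end Degrees

/-! ### The lexicographic order -/

section VariableOrder

variable {α : Type*} [LinearOrder α] {p : Sym2 α → Prop}

/-- The key by which the variables `y_e` are sorted: first by the larger end of `e`, then by the
smaller one in the opposite direction. -/
def edgeKey (e : Sym2 α) : α ×ₗ αᵒᵈ :=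
  toLex (e.sup, OrderDual.toDual e.inf)

theorem edgeKey_injective : Function.Injective (edgeKey : Sym2 α → α ×ₗ αᵒᵈ) := by
  intro e f h
  have h' := Prod.mk.inj (toLex.injective h)
  exact Sym2.inf_eq_inf_and_sup_eq_sup.1 ⟨OrderDual.toDual.injective h'.2, h'.1⟩

theorem edgeKey_lt_iff {e f : Sym2 α} :
    edgeKey e < edgeKey f ↔ e.sup < f.sup ∨ e.sup = f.sup ∧ f.inf < e.inf := by
  simp [edgeKey, Prod.Lex.toLex_lt_toLex]

/-- The key by which all variables are sorted: the variables `y` precede the variables `x`. -/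
def varKey : α ⊕ Subtype p → (α ×ₗ αᵒᵈ) ⊕ₗ α :=
  Sum.elim (fun i => toLex (Sum.inr i)) fun e => toLex (Sum.inl (edgeKey e.1))

theorem varKey_injective : Function.Injective (varKey : α ⊕ Subtype p → (α ×ₗ αᵒᵈ) ⊕ₗ α) := by
  rintro (i | e) (j | f) h
  · exact congrArg Sum.inl (Sum.inr_injective (toLex.injective h))
  · exact absurd (toLex.injective h) (by simp)
  · exact absurd (toLex.injective h) (by simp)
  · exact congrArg Sum.inr
      (Subtype.ext (edgeKey_injective (Sum.inl_injective (toLex.injective h))))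

/-- The order of the variables. Since `MonomialOrder.lex` gives the most weight to the smallest
index, the largest variable is the `y_e` with the smallest `edgeKey`. -/
@[reducible] noncomputable def varOrder (p : Sym2 α → Prop) : LinearOrder (α ⊕ Subtype p) :=
  LinearOrder.lift' varKey varKey_injective

theorem toSyn_lexOrder_lt {σ : Type*} [Finite σ] (r : LinearOrder σ) {a b : σ →₀ ℕ} {i : σ}
    (hi : a i < b i) (h : ∀ j, j < i → a j = b j) :
    (lexOrder r).toSyn a < (lexOrder r).toSyn b :=
  ⟨i, h, hi⟩

theorem toSyn_lexOrder_varOrder_lt [Finite (α ⊕ Subtype p)] {a b : α ⊕ Subtype p →₀ ℕ}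
    {z : Subtype p} (hz : a (Sum.inr z) < b (Sum.inr z))
    (h : ∀ e : Subtype p, edgeKey e.1 < edgeKey z.1 → a (Sum.inr e) = b (Sum.inr e)) :
    (lexOrder (varOrder p)).toSyn a < (lexOrder (varOrder p)).toSyn b := by
  refine toSyn_lexOrder_lt (varOrder p) hz fun s hs => ?_
  have hs : varKey s < varKey (Sum.inr z) := hs
  rcases s with i | e
  · exact absurd hs (by simp [varKey])
  · exact h e (by simpa [varKey] using hs)

end VariableOrder

/-! ### Minimal generators of the initial ideal have `x`-degree at most one -/

section Core

open Finsupp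

/-- A minimal generator `u` of the initial ideal and the smallest monomial `v` in its fibre form an
`x`-primitive pair if `u` has `x`-degree at least two. The hypotheses are symmetric in `u`
and `v`. -/
theorem isXPrimitive_of_not_isInitial {α : Type*} {p : Sym2 α → Prop}
    {m : MonomialOrder (α ⊕ Subtype p)}
    {u v : α ⊕ Subtype p →₀ ℕ} (hco : ∀ s, u s = 0 ∨ v s = 0)
    (hu : ∀ w ≤ u, w ≠ u → ¬ m.IsInitial (reesDeg p) w)
    (hv : ∀ w ≤ v, w ≠ v → ¬ m.IsInitial (reesDeg p) w)
    (hx : xDeg p u = xDeg p v) (h2 : 2 ≤ xDeg p u) : IsXPrimitive u v := by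
  intro a ha b hb hab hxab hx1
  have hπ : reesDeg p a = reesDeg p b := reesDeg_eq_iff.2 ⟨hab, hxab⟩
  rcases lt_trichotomy (m.toSyn a) (m.toSyn b) with hlt | heq | hlt
  · refine absurd ⟨a, hπ, hlt⟩ (hv b hb ?_)
    rintro rfl
    omega
  · have hab := m.toSyn.injective heq
    subst hab
    have : a = 0 := by
      ext s
      have h1 := ha s
      have h2 := hb s
      rcases hco s with h | h <;> simp only [Finsupp.coe_zero, Pi.zero_apply] <;> omega
    exact ⟨this, this⟩
  · refine absurd ⟨b, hπ.symm, hlt⟩ (hu a ha ?_)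
    rintro rfl
    omega

variable {α : Type*} [LinearOrder α] {p : Sym2 α → Prop} [Finite (α ⊕ Subtype p)]

/-- The exchange argument: let `z` be the largest variable `y` in `u` and `v`, and suppose that it
divides `v`. The closed trail through `z` and a trail through another edge `g` can be joined by an
edge `e` from an end of `z` to an end of `g`. This cuts `v` into two proper divisors, and the one
that contains `z` is initial since `y_e` is smaller than `z`. -/
theorem false_of_largest_mem_right
    (hstar : ∀ i j k, i ≠ j → p s(i, j) → i < k → j < k → p s(i, k) ∨ p s(j, k))
    (hstarstar : ∀ i j, p s(i, i) → i < j → ∀ k, p s(k, j) → p s(i, j) ∨ p s(i, k))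
    {u v : α ⊕ Subtype p →₀ ℕ} (hprim : IsXPrimitive u v) (hco : ∀ s, u s = 0 ∨ v s = 0)
    (hv : ∀ w ≤ v, w ≠ v → ¬ (lexOrder (varOrder p)).IsInitial (reesDeg p) w)
    (h : vertexDeg p u = vertexDeg p v) (hx : xDeg p u = xDeg p v) (h2 : 2 ≤ xDeg p u)
    {z : Subtype p} (hz : v (Sum.inr z) ≠ 0)
    (hmax : ∀ e : Subtype p, u (Sum.inr e) ≠ 0 ∨ v (Sum.inr e) ≠ 0 →
      edgeKey z.1 ≤ edgeKey e.1) : False := by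
  obtain ⟨U, V, s, t, hst, hclosed⟩ := hprim.exists_closed_trail h hz
  have hUV : U ≤ u ∧ V ≤ v ∧ vertexDeg p U = vertexDeg p V ∧
      xDeg p u = 2 * s + xDeg p U ∧ xDeg p v = 2 * t + xDeg p V := by
    obtain ⟨a, b, a', b', rfl, rfl, hab, hab', rfl, hs, rfl, ht⟩ :=
      hclosed z.1.out.1 (Sym2.out_fst_mem _)
    refine ⟨le_add_self, le_add_self, ?_, ?_, ?_⟩
    · simp only [map_add] at h hab'
      apply add_left_cancel (a := vertexDeg p a + vertexDeg p a')
      rw [h, add_right_comm (vertexDeg p (single (Sum.inr z) 1)), hab', hab]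
      abel
    · simp only [map_add, hs]
      ring
    · simp only [map_add, ht, xDeg_single_inr]
      ring
  obtain ⟨hU, hV, hUVdeg, hxU, hxV⟩ := hUV
  -- outside the closed trail there is an edge `g` with trails of the opposite kind from its ends
  have hg : ∃ g : Subtype p, (u (Sum.inr g) ≠ 0 ∨ v (Sum.inr g) ≠ 0) ∧ ∀ k ∈ g.1, ∃ a ≤ U, ∃ b ≤ V,
      vertexDeg p a = vertexDeg p b + single k 1 ∧ xDeg p a = t ∧ xDeg p b = s := by
    rcases Nat.eq_zero_or_pos s with hs | hs
    · obtain ⟨g, hg, H⟩ := (hprim.mono hU hV).exists_edge_right hUVdeg (by omega)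
      refine ⟨g, Or.inr fun h0 => hg ?_, fun k hk => ?_⟩
      · have := hV (Sum.inr g)
        omega
      · obtain ⟨a, ha, b, hb, hab, hxa, hxb⟩ := H k hk
        exact ⟨a, ha, b, le_add_self.trans hb, hab, by omega, by omega⟩
    · obtain ⟨g, hg, H⟩ := (hprim.mono hU hV).exists_edge_left hUVdeg (by omega)
      refine ⟨g, Or.inl fun h0 => hg ?_, fun k hk => ?_⟩
      · have := hU (Sum.inr g)
        omega
      · obtain ⟨a, ha, b, hb, hab, hxa, hxb⟩ := H k hk
        exact ⟨a, ha, b, hb, hab, by omega, by omega⟩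
  obtain ⟨g, hguv, hg⟩ := hg
  -- a common end of `z` and `g` would give a balanced pair of `x`-degree one
  have hdisj : ∀ k ∈ z.1, k ∉ g.1 := by
    intro k hkz hkg
    obtain ⟨a, b, a', b', rfl, rfl, hab, hab', hxa, hxa', hxb, hxb'⟩ := hclosed k hkz
    obtain ⟨c, hc, d, hd, hcd, hxc, hxd⟩ := hg k hkg
    have := (hprim (a' + c) (by
        rw [add_assoc]; exact (add_le_add_right hc _).trans le_add_self)
      (single (Sum.inr z) 1 + b' + d) (by
        rw [add_right_comm _ b]; exact (add_le_add_left le_self_add _).trans (by gcongr)) ?_ ?_ ?_).2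
    · simp at this
    · rw [map_add, hcd, map_add, hab']
      abel
    · simp only [map_add, xDeg_single_inr]
      omega
    · simp only [map_add]
      omega
  have hjoin : ∀ c ∈ z.1, ∀ k ∈ g.1, ∀ hp : p s(c, k), ¬ edgeKey z.1 < edgeKey s(c, k) := by
    intro c hc k hk hp hlt
    set e : Subtype p := ⟨s(c, k), hp⟩
    obtain ⟨a, b, a', b', rfl, rfl, hab, hab', hxa, hxa', hxb, hxb'⟩ := hclosed c hc
    obtain ⟨a₁, ha₁, b₁, hb₁, hab₁, hxa₁, hxb₁⟩ := hg k hk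
    obtain ⟨U, rfl⟩ := exists_add_of_le ha₁
    obtain ⟨V, rfl⟩ := exists_add_of_le hb₁
    refine hv (single (Sum.inr z) 1 + b' + V) ?_ ?_
      ⟨a' + U + single (Sum.inr e) 1, reesDeg_eq_iff.2 ⟨?_, ?_⟩, ?_⟩
    · rw [add_right_comm _ b, add_assoc _ b, ← add_assoc b, add_comm (b + b₁), ← add_assoc]
      exact le_self_add
    · intro heq
      have := congrArg (xDeg p) heq
      simp only [map_add, xDeg_single_inr] at this
      omega
    · rw [map_add, map_add, vertexDeg_single_inr (i := c) (j := k) rfl, map_add _ _ V, hab']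
      simp only [map_add] at hUVdeg
      apply add_left_cancel (a := vertexDeg p b₁)
      rw [show vertexDeg p b₁ + (vertexDeg p a' + single c 1 + vertexDeg p V) =
        (vertexDeg p b₁ + vertexDeg p V) + (vertexDeg p a' + single c 1) by abel, ← hUVdeg, hab₁]
      abel
    · simp only [map_add, xDeg_single_inr] at hx hxU hxV ⊢
      omega
    · have hne (f : Subtype p) (hf : edgeKey f.1 ≤ edgeKey z.1) :
          single (Sum.inr e : α ⊕ Subtype p) 1 (Sum.inr f) = 0 := by
        rw [single_eq_of_ne]
        intro hfe
        obtain rfl := Sum.inr_injective hfe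
        exact hf.not_gt hlt
      apply toSyn_lexOrder_varOrder_lt (z := z)
      · have huz := (hco (Sum.inr z)).resolve_right hz
        have hez := hne z le_rfl
        simp only [Finsupp.add_apply, single_eq_same] at huz hez ⊢
        omega
      · intro f hf
        have hef := hne f hf.le
        have huf := mt (hmax f) hf.not_ge
        push Not at huf
        simp only [Finsupp.add_apply] at huf hef ⊢
        omega
  -- `g` reaches beyond `z`, since `z` is the largest variable
  have hsup : z.1.sup < g.1.sup := by
    have h1 : ∀ e : Sym2 α, e.sup ∈ e := by
      intro e
      induction e with | _ i j
      rcases le_total i j with hij | hij <;> simp [hij]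
    have hle : z.1.sup ≤ g.1.sup := by
      by_contra! hcon
      exact (hmax g hguv).not_gt (edgeKey_lt_iff.2 (Or.inl hcon))
    refine lt_of_le_of_ne hle fun heq => hdisj _ (h1 _) ?_
    rw [heq]
    exact h1 _
  obtain ⟨k, l, hkl, hgkl⟩ : ∃ k l, k ≤ l ∧ g.1 = s(k, l) := by
    obtain ⟨g, hg'⟩ := g
    induction g with | _ k l
    rcases le_total k l with hkl | hkl
    · exact ⟨k, l, hkl, rfl⟩
    · exact ⟨l, k, hkl, Sym2.eq_swap⟩
  obtain ⟨c, d, hzcd⟩ : ∃ c d, z.1 = s(c, d) := by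
    obtain ⟨z, hz'⟩ := z
    induction z with | _ c d
    exact ⟨c, d, rfl⟩
  have hpz := z.2
  have hpg := g.2
  rw [hzcd] at hpz hsup hdisj hjoin
  rw [hgkl] at hpg hsup hdisj hjoin
  rw [Sym2.sup_mk, Sym2.sup_mk, sup_eq_right.2 hkl, sup_lt_iff] at hsup
  have hl : ∀ i ∈ s(c, d), ¬ p s(i, l) := fun i hi hp => hjoin i hi l (by simp) hp <| by
    refine edgeKey_lt_iff.2 (Or.inl ?_)
    rw [Sym2.sup_mk, Sym2.sup_mk]
    exact (sup_lt_iff.2 hsup).trans_le le_sup_right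
  by_cases hcd : c = d
  · subst hcd
    rcases hstarstar c l hpz hsup.1 k hpg with hp | hp
    · exact hl c (by simp) hp
    · refine hjoin c (by simp) k (by simp) hp (edgeKey_lt_iff.2 ?_)
      have hck : c ≠ k := by
        rintro rfl
        exact hdisj c (by simp) (by simp)
      rcases hck.lt_or_gt with hck | hck
      · exact Or.inl (by simpa using hck)
      · exact Or.inr ⟨by simpa using hck.le, by simpa using hck⟩
  · rcases hstar c d l hcd hpz hsup.1 hsup.2 with hp | hp
    · exact hl c (by simp) hp
    · exact hl d (by simp) hp

theorem xDeg_le_one_of_minimal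
    (hstar : ∀ i j k, i ≠ j → p s(i, j) → i < k → j < k → p s(i, k) ∨ p s(j, k))
    (hstarstar : ∀ i j, p s(i, i) → i < j → ∀ k, p s(k, j) → p s(i, j) ∨ p s(i, k))
    {u v : α ⊕ Subtype p →₀ ℕ} (hne : u ≠ v) (hπ : reesDeg p u = reesDeg p v)
    (hu : ∀ w ≤ u, w ≠ u → ¬ (lexOrder (varOrder p)).IsInitial (reesDeg p) w)
    (hv : ¬ (lexOrder (varOrder p)).IsInitial (reesDeg p) v) :
    xDeg p u ≤ 1 := by
  by_contra! h2
  replace h2 : 2 ≤ xDeg p u := h2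
  obtain ⟨h, hx⟩ := reesDeg_eq_iff.1 hπ
  have hv' : ∀ w ≤ v, w ≠ v → ¬ (lexOrder (varOrder p)).IsInitial (reesDeg p) w :=
    fun w hw _ hin => hv (hin.mono hw)
  -- a common variable could be cancelled
  have hco : ∀ s, u s = 0 ∨ v s = 0 := by
    by_contra! hcon
    obtain ⟨s, hus, hvs⟩ := hcon
    obtain ⟨u, rfl⟩ := exists_add_of_apply_ne_zero hus
    obtain ⟨v, rfl⟩ := exists_add_of_apply_ne_zero hvs
    have hπ' : reesDeg p v = reesDeg p u := by
      rw [map_add, map_add] at hπ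
      exact (add_left_cancel hπ).symm
    rcases lt_trichotomy ((lexOrder (varOrder p)).toSyn u) ((lexOrder (varOrder p)).toSyn v) with
      hlt | heq | hlt
    · exact hv' v le_add_self (by simp) ⟨u, hπ'.symm, hlt⟩
    · exact hne (by rw [(lexOrder (varOrder p)).toSyn.injective heq])
    · exact hu u le_add_self (by simp) ⟨v, hπ', hlt⟩
  have hprim := isXPrimitive_of_not_isInitial hco hu hv' hx h2
  obtain ⟨g, hg⟩ : ∃ g : Subtype p, v (Sum.inr g) ≠ 0 :=
    (hprim.exists_edge_right h (by omega)).imp fun _ hg => hg.1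
  have hfin : Finite (Subtype p) := Finite.of_injective _ (Sum.inr_injective (α := α))
  have hS : {e : Subtype p | u (Sum.inr e) ≠ 0 ∨ v (Sum.inr e) ≠ 0}.Finite := Set.toFinite _
  obtain ⟨z, hz, hmin⟩ := Set.exists_min_image _ (fun e : Subtype p => edgeKey e.1) hS
    ⟨g, Or.inr hg⟩
  rcases hz with hz | hz
  · exact false_of_largest_mem_right hstar hstarstar hprim.symm (fun s => (hco s).symm) hu h.symm
      hx.symm (hx ▸ h2) hz fun e he => hmin e he.symm
  · exact false_of_largest_mem_right hstar hstarstar hprim hco hv' h hx h2 hz hmin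

end Core

/-! ### The defining ideal of the Rees ring -/

section Rees

variable {K : Type*} [Field K] {n : ℕ} {I : Ideal (MvPolynomial (Fin n) K)}

theorem coe_reesMap_X (s : ReesVar I) :
    (reesMap I (X s) : Polynomial (MvPolynomial (Fin n) K)) =
      Polynomial.monomial (yDeg (fun e => quadMonomial K e ∈ I) (Finsupp.single s 1))
        (monomial (vertexDeg (fun e => quadMonomial K e ∈ I) (Finsupp.single s 1)) 1) := by
  rw [reesMap, aeval_X]
  rcases s with i | ⟨⟨i, j⟩, he⟩
  · rw [yDeg_single_inl, vertexDeg_single_inl]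
    rfl
  · rw [yDeg_single_inr, vertexDeg_single_inr (i := i) (j := j) rfl, ← one_mul (1 : K),
      ← monomial_mul]
    rfl

theorem coe_reesMap_monomial (u : ReesVar I →₀ ℕ) (c : K) :
    (reesMap I (monomial u c) : Polynomial (MvPolynomial (Fin n) K)) =
      Polynomial.monomial (yDeg (fun e => quadMonomial K e ∈ I) u)
        (monomial (vertexDeg (fun e => quadMonomial K e ∈ I) u) c) := by
  induction u using Finsupp.induction_linear generalizing c with
  | zero =>
    rw [map_zero, map_zero, ← C_apply, ← C_apply, ← algebraMap_eq, AlgHom.commutes]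
    rfl
  | add u v hu hv =>
    rw [← mul_one c, ← monomial_mul, map_mul, MulMemClass.coe_mul, hu, hv,
      Polynomial.monomial_mul_monomial, monomial_mul, map_add, map_add]
  | single s k =>
    induction k generalizing c with
    | zero =>
      rw [Finsupp.single_zero, map_zero, map_zero, ← C_apply, ← C_apply, ← algebraMap_eq,
        AlgHom.commutes]
      rfl
    | succ k ih =>
      rw [Finsupp.single_add, ← mul_one c, ← monomial_mul, map_mul, MulMemClass.coe_mul, ih,
        ← X, coe_reesMap_X, Polynomial.monomial_mul_monomial, monomial_mul, map_add, map_add]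

theorem monomial_sub_monomial_mem_reesIdeal {u v : ReesVar I →₀ ℕ}
    (h : reesDeg (fun e => quadMonomial K e ∈ I) u = reesDeg (fun e => quadMonomial K e ∈ I) v) :
    monomial u 1 - monomial v 1 ∈ reesIdeal I := by
  rw [reesIdeal, RingHom.mem_ker, map_sub, sub_eq_zero]
  apply Subtype.ext
  rw [reesDeg, AddMonoidHom.prod_apply, AddMonoidHom.prod_apply, Prod.mk.injEq] at h
  rw [coe_reesMap_monomial, coe_reesMap_monomial, h.1, h.2]

/-- In the image of an element of `P`, the terms with a common image cancel. -/
theorem exists_mem_support_of_mem_reesIdeal {f : MvPolynomial (ReesVar I) K}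
    (hf : f ∈ reesIdeal I) {u : ReesVar I →₀ ℕ} (hu : u ∈ f.support) :
    ∃ v ∈ f.support, v ≠ u ∧
      reesDeg (fun e => quadMonomial K e ∈ I) v = reesDeg (fun e => quadMonomial K e ∈ I) u := by
  by_contra! hcon
  rw [reesIdeal, RingHom.mem_ker] at hf
  have h0 : (reesAlgebra I).val (reesMap I f) = 0 := by
    rw [hf, map_zero]
  rw [f.as_sum, map_sum, map_sum] at h0
  have h1 := congrArg (fun q => coeff (vertexDeg (fun e => quadMonomial K e ∈ I) u)
    (Polynomial.coeff q (yDeg (fun e => quadMonomial K e ∈ I) u))) h0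
  simp only [Subalgebra.val_apply, coe_reesMap_monomial, Polynomial.finsetSum_coeff,
    coeff_sum, Polynomial.coeff_zero, coeff_zero] at h1
  rw [Finset.sum_eq_single u] at h1
  · rw [Polynomial.coeff_monomial_same, coeff_monomial, if_pos rfl] at h1
    exact mem_support_iff.1 hu h1
  · intro v hv hvu
    have hne := hcon v hv hvu
    rw [Polynomial.coeff_monomial]
    split_ifs with hy
    · rw [coeff_monomial, if_neg]
      exact fun hx => hne (Prod.ext hx hy)
    · exact coeff_zero _
  · exact fun h => absurd hu h

end Rees

theorem theorem3p1 {K : Type*} [Field K] (n : ℕ) (I : Ideal (MvPolynomial (Fin n) K))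
    (hI : IsGeneratedByQuadMonomials I)
    (hstar : ∀ i j k : Fin n, i ≠ j → X i * X j ∈ I → i < k → j < k →
      X i * X k ∈ I ∨ X j * X k ∈ I)
    (hstarstar : ∀ i j : Fin n, X i ^ 2 ∈ I → i < j → ∀ k : Fin n, X k * X j ∈ I →
      X i * X j ∈ I ∨ X i * X k ∈ I) :
    ∃ (r : LinearOrder (ReesVar I)) (G : Finset (MvPolynomial (ReesVar I) K)),
      IsReducedGroebnerBasis (lexOrder r) (reesIdeal I) G ∧
        ∀ f ∈ G, IsBinomial f ∧ xDegree f ≤ 1 := by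
  set p : Sym2 (Fin n) → Prop := fun e => quadMonomial K e ∈ I
  obtain ⟨G, hG, hbin⟩ := exists_isReducedGroebnerBasis_of_fiber (lexOrder (varOrder p))
    (reesDeg p) (reesIdeal I) (fun _ _ => monomial_sub_monomial_mem_reesIdeal)
    (fun _ hf _ => exists_mem_support_of_mem_reesIdeal hf)
  refine ⟨varOrder p, G, hG, fun f hf => ?_⟩
  obtain ⟨u, v, rfl, hne, hπ, hu, hv⟩ := hbin f hf
  refine ⟨⟨u, v, hne, rfl⟩, ?_⟩
  have hxu : xDeg p u ≤ 1 := xDeg_le_one_of_minimal (p := p) hstar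
    (fun i j hi => hstarstar i j (by rwa [pow_two])) hne hπ hu hv
  have hxv : xDeg p v ≤ 1 := (reesDeg_eq_iff.1 hπ).2 ▸ hxu
  refine Finset.sup_le fun d hd => ?_
  rcases Finset.mem_union.1 (support_sub _ _ _ hd) with h | h
  · rw [Finset.mem_singleton.1 (support_monomial_subset h)]
    exact hxu
  · rw [Finset.mem_singleton.1 (support_monomial_subset h)]
    exact hxv
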